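/- Let $M$ be a smooth manifold and $E\to M$ a smooth real vector bundle of finite rank. Let $\mathfrak{D}E$ be the gauge Lie algebroid of $E$: its sections are the $\mathbb{R}$-linear operators $\mathfrak d$ on $\Gamma(E)$ for which there is a vector field $X$ with $\mathfrak d(fu)=f\,\mathfrak d(u)+X(f)u$ for all $f\in C^\infty(M)$, $u\in\Gamma(E)$, with the commutator bracket $[\cdot,\cdot]_{\mathfrak D}$. Let $\mathfrak{J}E$ be the first jet bundle, identified with $$\{\nu\in\mathrm{Hom}(\mathfrak{D}E,E)\mid \nu(\Phi)=\Phi(\nu(\mathrm{id}_E))\ \text{for all } \Phi\in\mathrm{gl}(E)\},$$ with pairing $\langle\mu,\mathfrak d\rangle_E=\langle \mathfrak d,\mu\rangle_E=\mu(\mathfrak d)$. Put $(\mathbb{d}u)(\mathfrak d)=\mathfrak d(u)$ for $u\in\Gamma(E)$ and $\langle\mathfrak L_{\mathfrak d}\mu,\mathfrak t\rangle_E=\mathfrak d\langle\mu,\mathfrak t\rangle_E-\langle\mu,[\mathfrak d,\mathfrak t]_{\mathfrak D}\rangle_E$. The omni-Lie algebroid of $E$ is $\mathfrak{D}E\oplus\mathfrak{J}E$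 with the $E$-valued pairing and the bracket $$(\mathfrak d+\mu,\mathfrak t+\nu)_E=\tfrac12\big(\langle\mu,\mathfrak t\rangle_E+\langle\nu,\mathfrak d\rangle_E\big),\qquad \{\mathfrak d+\mu,\mathfrak t+\nu\}=[\mathfrak d,\mathfrak t]_{\mathfrak D}+\mathfrak L_{\mathfrak d}\nu-\mathfrak L_{\mathfrak t}\mu+\mathbb{d}(\mu(\mathfrak t)).$$ A bundle map $\mathcal J$ of $\mathfrak{D}E\oplus\mathfrak{J}E$ is a generalized almost complex structure if $\mathcal J^2=-\mathrm{id}$ and $(\mathcal JX,\mathcal JY)_E=(X,Y)_E$; it is a generalized complex structure if moreover $$\{\mathcal JX,\mathcal JY\}-\{X,Y\}-\mathcal J\big(\{\mathcal JX,Y\}+\{X,\mathcal JY\}\big)=0\quad\text{for all sections } X,Y.$$ Let $N:\mathfrak{D}E\to\mathfrak{D}E$ be a bundle map whose dual $N^\star(\nu)=\nu\circ N$ satisfies $N^\star(\mathfrak{J}E)\subset\mathfrak{J}E$. Let $\sigma:\wedge^2\mathfrak{D}E\to E$ be such that $\sigma_\natural(\mathfrak d):=\sigma(\mathfrak d,\cdot)$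 lies in $\mathfrak{J}E$ for all $\mathfrak d$. Let $\pi:\wedge^2\mathfrak{J}E\to E$ be such that for every $\mu$ there is an element $\pi^\sharp(\mu)$ of $\mathfrak{D}E$ with $\pi(\mu,\nu)=\langle\nu,\pi^\sharp(\mu)\rangle_E$ for all $\nu$. Suppose that $$\mathcal J=\begin{pmatrix}N&\pi^\sharp\\ \sigma_\natural&-N^\star\end{pmatrix}$$ is a generalized almost complex structure on $\mathfrak{D}E\oplus\mathfrak{J}E$. Put $$[\mu,\nu]_\pi=\mathfrak L_{\pi^\sharp(\mu)}\nu-\mathfrak L_{\pi^\sharp(\nu)}\mu-\mathbb{d}\langle\pi^\sharp(\mu),\nu\rangle_E,$$ $$T(N)(\mathfrak d,\mathfrak t)=[N\mathfrak d,N\mathfrak t]_{\mathfrak D}-N\big([N\mathfrak d,\mathfrak t]_{\mathfrak D}+[\mathfrak d,N\mathfrak t]_{\mathfrak D}-N[\mathfrak d,\mathfrak t]_{\mathfrak D}\big),\qquad \sigma_N(\mathfrak d,\mathfrak t)=\sigma(N\mathfrak d,\mathfrak t),$$ and, for a 2-form $\omega$ on $\mathfrak{D}E$ with values in $E$, $$\mathbb{d}\omega(\mathfrak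 d,\mathfrak t,\mathfrak k)=\mathfrak d\,\omega(\mathfrak t,\mathfrak k)-\mathfrak t\,\omega(\mathfrak d,\mathfrak k)+\mathfrak k\,\omega(\mathfrak d,\mathfrak t)-\omega([\mathfrak d,\mathfrak t]_{\mathfrak D},\mathfrak k)+\omega([\mathfrak d,\mathfrak k]_{\mathfrak D},\mathfrak t)-\omega([\mathfrak t,\mathfrak k]_{\mathfrak D},\mathfrak d).$$ Then $\mathcal J$ is a generalized complex structure if and only if the following four conditions hold for all $\mu,\nu\in\Gamma(\mathfrak{J}E)$ and $\mathfrak d,\mathfrak t,\mathfrak k\in\Gamma(\mathfrak{D}E)$: (i) $\pi^\sharp([\mu,\nu]_\pi)=[\pi^\sharp(\mu),\pi^\sharp(\nu)]_{\mathfrak D}$; (ii) $N^\star([\mu,\nu]_\pi)=\mathfrak L_{\pi^\sharp(\mu)}(N^\star(\nu))-\mathfrak L_{\pi^\sharp(\nu)}(N^\star(\mu))-\mathbb{d}\,\pi(N^\star(\mu),\nu)$; (iii) $T(N)(\mathfrak d,\mathfrak t)=\pi^\sharp(i_{\mathfrak d\wedge\mathfrak t}\mathbb{d}\sigma)$, where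 $i_{\mathfrak d\wedge\mathfrak t}\mathbb{d}\sigma=\mathbb{d}\sigma(\mathfrak d,\mathfrak t,\cdot)\in\Gamma(\mathfrak{J}E)$; (iv) $\mathbb{d}\sigma(N\mathfrak d,\mathfrak t,\mathfrak k)+\mathbb{d}\sigma(\mathfrak d,N\mathfrak t,\mathfrak k)+\mathbb{d}\sigma(\mathfrak d,\mathfrak t,N\mathfrak k)=\mathbb{d}\sigma_N(\mathfrak d,\mathfrak t,\mathfrak k)$. -/

import Mathlib

open scoped Manifold ContDiff Bundle

namespace OmniLie

noncomputable section

/-! ## Sections of a smooth vector bundle as a module over the smooth functions -/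

section Sections

variable {n : ℕ} {M : Type*} [TopologicalSpace M] [ChartedSpace (EuclideanSpace ℝ (Fin n)) M]
  {F : Type*} [NormedAddCommGroup F] [NormedSpace ℝ F]
  {E : M → Type*} [TopologicalSpace (Bundle.TotalSpace F E)]
  [∀ x, AddCommGroup (E x)] [∀ x, Module ℝ (E x)] [∀ x, TopologicalSpace (E x)]
  [FiberBundle F E] [VectorBundle ℝ F E]

/-- The module structure of `Γ(E)` over `C^∞(M)`: pointwise multiplication. -/
instance sectionModule : Module C^∞⟮𝓡 n, M; ℝ⟯ Cₛ^∞⟮𝓡 n; F, E⟯ where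
  smul f s := ⟨fun x => f x • s x, ContMDiff.smul_section f.contMDiff s.contMDiff⟩
  one_smul s := by ext x; exact one_smul ℝ (s x)
  mul_smul f g s := by ext x; exact mul_smul (f x) (g x) (s x)
  smul_zero f := by ext x; exact smul_zero (f x)
  smul_add f s t := by ext x; exact smul_add (f x) (s x) (t x)
  add_smul f g s := by ext x; exact add_smul (f x) (g x) (s x)
  zero_smul s := by ext x; exact zero_smul ℝ (s x)

@[simp] theorem section_smul_apply (f : C^∞⟮𝓡 n, M; ℝ⟯) (s : Cₛ^∞⟮𝓡 n; F, E⟯) (x : M) :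
    (f • s) x = f x • s x := rfl

instance sectionTower :
    IsScalarTower ℝ C^∞⟮𝓡 n, M; ℝ⟯ Cₛ^∞⟮𝓡 n; F, E⟯ where
  smul_assoc r f s := by ext x; exact smul_assoc r (f x) (s x)

end Sections

/-! ## The omni-Lie algebroid

All bundles below are described by their `C^∞(M)`-modules of smooth sections, and vector bundle
maps (covering the identity of `M`) by the `C^∞(M)`-linear maps which they induce on sections.
In this part `A` stands for `C^∞(M)` and `S` for `Γ(E)`. -/

section Omni

variable (A S : Type*) [CommRing A] [Algebra ℝ A] [AddCommGroup S] [Module ℝ S] [Module A S]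
  [IsScalarTower ℝ A S]

/-- `Γ(𝔇E)`, the sections of the gauge Lie algebroid, i.e. of the bundle of covariant differential
operators of `E`: the `ℝ`-linear operators `D` on `Γ(E)` for which there is a vector field `X`
(a derivation of `C^∞(M)`) with `D (f u) = f D u + X(f) u`. -/
def GaugeSec : Submodule A (S →ₗ[ℝ] S) where
  carrier := {D | ∃ X : Derivation ℝ A A, ∀ (f : A) (u : S), D (f • u) = f • D u + X f • u}
  zero_mem' := ⟨0, fun f u => by simp⟩
  add_mem' := by
    rintro D D' ⟨X, hX⟩ ⟨X', hX'⟩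
    refine ⟨X + X', fun f u => ?_⟩
    simp only [LinearMap.add_apply, hX, hX', Derivation.add_apply, smul_add, add_smul]
    abel
  smul_mem' := by
    rintro g D ⟨X, hX⟩
    refine ⟨g • X, fun f u => ?_⟩
    simp only [LinearMap.smul_apply, hX, Derivation.smul_apply, smul_add, smul_smul, smul_eq_mul,
      mul_comm g f]

variable {A S}

/-- The inclusion `Γ(gl(E)) → Γ(𝔇E)`: a bundle endomorphism is a covariant differential operator
whose vector field vanishes. -/
def glToGauge (Φ : S →ₗ[A] S) : GaugeSec A S :=
  ⟨Φ.restrictScalars ℝ, 0, fun f u => by simp⟩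

/-- The commutator bracket `[·,·]_𝔇` on `Γ(𝔇E)`. -/
def gaugeBracket (d t : GaugeSec A S) : GaugeSec A S :=
  ⟨d.1 ∘ₗ t.1 - t.1 ∘ₗ d.1, by
    obtain ⟨d, X, hX⟩ := d
    obtain ⟨t, Y, hY⟩ := t
    refine ⟨⁅X, Y⁆, fun f u => ?_⟩
    simp only [LinearMap.sub_apply, LinearMap.comp_apply, hX, hY, map_add, smul_sub,
      Derivation.commutator_apply, sub_smul]
    abel⟩

theorem gaugeBracket_apply (d t : GaugeSec A S) (u : S) :
    (gaugeBracket d t).1 u = d.1 (t.1 u) - t.1 (d.1 u) := rfl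

variable (A S) in
/-- `Γ(𝔍E)`, the sections of the first jet bundle, as the `E`-dual bundle of `𝔇E`:
the bundle maps `ν : 𝔇E → E` with `ν(Φ) = Φ(ν(id_E))` for all `Φ` in `gl(E)`. -/
def JetSec : Submodule A (GaugeSec A S →ₗ[A] S) where
  carrier := {ν | ∀ Φ : S →ₗ[A] S, ν (glToGauge Φ) = Φ (ν (glToGauge LinearMap.id))}
  zero_mem' := fun Φ => by simp
  add_mem' := fun {μ ν} hμ hν Φ => by
    simp only [LinearMap.add_apply, hμ Φ, hν Φ, map_add]
  smul_mem' := fun g ν hν Φ => by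
    simp only [LinearMap.smul_apply, hν Φ, map_smul]

/-- The `E`-valued pairing `⟨μ, d⟩_E` of `𝔍E` with `𝔇E`. -/
def pairE (μ : JetSec A S) (d : GaugeSec A S) : S := μ.1 d

/-- `𝕕 : Γ(E) → Γ(𝔍E)`, `(𝕕 u)(d) = d(u)`. -/
def jetD (u : S) : JetSec A S :=
  ⟨{ toFun := fun d => d.1 u
     map_add' := fun _ _ => rfl
     map_smul' := fun _ _ => rfl }, fun _ => rfl⟩

theorem gaugeBracket_add_right (d t s : GaugeSec A S) :
    gaugeBracket d (t + s) = gaugeBracket d t + gaugeBracket d s := by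
  apply Subtype.ext
  ext u
  simp only [gaugeBracket_apply, Submodule.coe_add, LinearMap.add_apply, map_add]
  abel

theorem gaugeBracket_smul_right (d t : GaugeSec A S) (X : Derivation ℝ A A)
    (hX : ∀ (f : A) (u : S), d.1 (f • u) = f • d.1 u + X f • u) (f : A) :
    gaugeBracket d (f • t) = f • gaugeBracket d t + X f • t := by
  apply Subtype.ext
  ext u
  simp only [gaugeBracket_apply, Submodule.coe_add, LinearMap.add_apply, Submodule.coe_smul,
    LinearMap.smul_apply, hX, smul_sub]
  abel

theorem gaugeBracket_gl (d : GaugeSec A S) (Φ : S →ₗ[A] S) :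
    ∃ Ψ : S →ₗ[A] S, gaugeBracket d (glToGauge Φ) = glToGauge Ψ ∧
      ∀ u, Ψ u = d.1 (Φ u) - Φ (d.1 u) := by
  obtain ⟨X, hX⟩ := d.2
  refine ⟨{ toFun := fun u => d.1 (Φ u) - Φ (d.1 u), map_add' := ?_, map_smul' := ?_ }, rfl,
    fun _ => rfl⟩
  · intro u v
    simp only [map_add]
    abel
  · intro f u
    simp only [map_smul, hX, map_add, RingHom.id_apply, smul_sub]
    abel

theorem gaugeBracket_id (d : GaugeSec A S) :
    gaugeBracket d (glToGauge (LinearMap.id : S →ₗ[A] S)) = 0 := by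
  apply Subtype.ext
  ext u
  exact sub_self (d.1 u)

/-- The Lie derivative `𝔏_d : Γ(𝔍E) → Γ(𝔍E)`:
`⟨𝔏_d μ, t⟩ = d⟨μ, t⟩ - ⟨μ, [d, t]⟩`. -/
def lieDeriv (d : GaugeSec A S) (μ : JetSec A S) : JetSec A S :=
  ⟨{ toFun := fun t => d.1 (pairE μ t) - pairE μ (gaugeBracket d t)
     map_add' := fun t s => by
       simp only [pairE, gaugeBracket_add_right, map_add]
       abel
     map_smul' := fun f t => by
       obtain ⟨X, hX⟩ := d.2
       simp only [pairE, gaugeBracket_smul_right d t X hX, map_add, map_smul, hX,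
         RingHom.id_apply, smul_sub]
       abel }, fun Φ => by
    obtain ⟨Ψ, hΨ, hΨ'⟩ := gaugeBracket_gl d Φ
    simp only [LinearMap.coe_mk, AddHom.coe_mk, pairE, gaugeBracket_id, hΨ, map_zero, sub_zero,
      μ.2 Φ, μ.2 Ψ, hΨ']
    abel⟩

variable (A S) in
/-- The sections of `𝔇E ⊕ 𝔍E`. -/
abbrev OmniSec : Type _ := GaugeSec A S × JetSec A S

/-- The `E`-valued pairing `(d + μ, t + ν)_E = ½ (⟨μ, t⟩_E + ⟨ν, d⟩_E)`. -/
def omniPair (e₁ e₂ : OmniSec A S) : S :=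
  (1 / 2 : ℝ) • (pairE e₁.2 e₂.1 + pairE e₂.2 e₁.1)

/-- The bracket `{d + μ, t + ν} = [d, t]_𝔇 + 𝔏_d ν - 𝔏_t μ + 𝕕 (μ(t))`. -/
def omniBracket (e₁ e₂ : OmniSec A S) : OmniSec A S :=
  (gaugeBracket e₁.1 e₂.1,
    lieDeriv e₁.1 e₂.2 - lieDeriv e₂.1 e₁.2 + jetD (pairE e₁.2 e₂.1))

/-- A generalized almost complex structure on the omni-Lie algebroid: a bundle map `J` with
`J² = -1` which preserves the pairing. -/
def IsGeneralizedAlmostComplex (J : OmniSec A S →ₗ[A] OmniSec A S) : Prop :=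
  (∀ e, J (J e) = -e) ∧ ∀ e₁ e₂, omniPair (J e₁) (J e₂) = omniPair e₁ e₂

/-- A generalized complex structure: an integrable generalized almost complex structure. -/
def IsGeneralizedComplex (J : OmniSec A S →ₗ[A] OmniSec A S) : Prop :=
  IsGeneralizedAlmostComplex J ∧
    ∀ e₁ e₂, omniBracket (J e₁) (J e₂) - omniBracket e₁ e₂
      - J (omniBracket (J e₁) e₂ + omniBracket e₁ (J e₂)) = 0

/-- `N^⋆ : 𝔍E → 𝔍E`, `N^⋆(ν)(d) = ν(N d)`, for a bundle map `N : 𝔇E → 𝔇E` whose `E`-dual maps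
`𝔍E` into `𝔍E`. -/
def dualMap (N : GaugeSec A S →ₗ[A] GaugeSec A S)
    (hN : ∀ ν ∈ JetSec A S, ν ∘ₗ N ∈ JetSec A S) : JetSec A S →ₗ[A] JetSec A S where
  toFun ν := ⟨ν.1 ∘ₗ N, hN ν.1 ν.2⟩
  map_add' _ _ := rfl
  map_smul' _ _ := rfl

variable (A S) in
/-- `Γ(Hom(∧²𝔇E, E)_{𝔍E})`: alternating `σ` with `σ(d, ·) ∈ 𝔍E` for all `d`. -/
structure GaugeTwoForm where
  form : GaugeSec A S →ₗ[A] GaugeSec A S →ₗ[A] S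
  alt : ∀ d, form d d = 0
  mem_jet : ∀ d, form d ∈ JetSec A S

/-- `σ_♮ : 𝔇E → 𝔍E`, `σ_♮(d)(t) = σ(d, t)`. -/
def GaugeTwoForm.flat (σ : GaugeTwoForm A S) : GaugeSec A S →ₗ[A] JetSec A S :=
  σ.form.codRestrict (JetSec A S) σ.mem_jet

variable (A S) in
/-- `Γ(Hom(∧²𝔍E, E)_{𝔇E})`: alternating `π` such that every `π(μ, ·)` is the pairing with an
element of `𝔇E`. -/
structure JetTwoForm where
  form : JetSec A S →ₗ[A] JetSec A S →ₗ[A] S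
  alt : ∀ μ, form μ μ = 0
  mem_gauge : ∀ μ, ∃ d : GaugeSec A S, ∀ ν, form μ ν = pairE ν d

/-- An element of `𝔇E` is determined by its pairings with `𝔍E`. -/
theorem gauge_ext {d t : GaugeSec A S} (h : ∀ ν : JetSec A S, pairE ν d = pairE ν t) : d = t := by
  apply Subtype.ext
  ext u
  exact h (jetD u)

/-- `π^♯ : 𝔍E → 𝔇E`, characterised by `⟨ν, π^♯(μ)⟩_E = π(μ, ν)`. -/
def JetTwoForm.sharp (P : JetTwoForm A S) : JetSec A S →ₗ[A] GaugeSec A S where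
  toFun μ := (P.mem_gauge μ).choose
  map_add' μ μ' := gauge_ext fun ν => by
    have h₁ := (P.mem_gauge (μ + μ')).choose_spec ν
    have h₂ := (P.mem_gauge μ).choose_spec ν
    have h₃ := (P.mem_gauge μ').choose_spec ν
    have h₄ : P.form (μ + μ') ν = P.form μ ν + P.form μ' ν := by
      rw [map_add, LinearMap.add_apply]
    rw [h₂, h₃] at h₄
    exact h₁.symm.trans (h₄.trans (map_add ν.1 _ _).symm)
  map_smul' f μ := gauge_ext fun ν => by
    have h₁ := (P.mem_gauge (f • μ)).choose_spec ν
    have h₂ := (P.mem_gauge μ).choose_spec ν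
    have h₃ : P.form (f • μ) ν = f • P.form μ ν := by
      rw [map_smul, LinearMap.smul_apply]
    rw [h₂] at h₃
    exact h₁.symm.trans (h₃.trans (map_smul ν.1 f _).symm)

theorem JetTwoForm.pairE_sharp (P : JetTwoForm A S) (μ ν : JetSec A S) :
    pairE ν (P.sharp μ) = P.form μ ν :=
  ((P.mem_gauge μ).choose_spec ν).symm

/-- The bundle map of `𝔇E ⊕ 𝔍E` with block matrix `(N, π^♯; σ_♮, -N^⋆)`. -/
def blockMap (N : GaugeSec A S →ₗ[A] GaugeSec A S)
    (hN : ∀ ν ∈ JetSec A S, ν ∘ₗ N ∈ JetSec A S) (P : JetTwoForm A S) (σ : GaugeTwoForm A S) :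
    OmniSec A S →ₗ[A] OmniSec A S where
  toFun e := (N e.1 + P.sharp e.2, σ.flat e.1 - dualMap N hN e.2)
  map_add' e e' := by
    ext1
    · simp only [Prod.fst_add, Prod.snd_add, map_add]
      abel
    · simp only [Prod.fst_add, Prod.snd_add, map_add]
      abel
  map_smul' f e := by
    ext1
    · simp only [Prod.smul_fst, Prod.smul_snd, map_smul, RingHom.id_apply, smul_add]
    · simp only [Prod.smul_fst, Prod.smul_snd, map_smul, RingHom.id_apply, smul_sub]

/-- `[μ, ν]_π = 𝔏_{π^♯ μ} ν - 𝔏_{π^♯ ν} μ - 𝕕⟨π^♯ μ, ν⟩_E`. -/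
def piBracket (P : JetTwoForm A S) (μ ν : JetSec A S) : JetSec A S :=
  lieDeriv (P.sharp μ) ν - lieDeriv (P.sharp ν) μ - jetD (pairE ν (P.sharp μ))

/-- The Nijenhuis tensor
`T(N)(d, t) = [N d, N t] - N ([N d, t] + [d, N t] - N [d, t])`. -/
def nijenhuis (N : GaugeSec A S →ₗ[A] GaugeSec A S) (d t : GaugeSec A S) : GaugeSec A S :=
  gaugeBracket (N d) (N t)
    - N (gaugeBracket (N d) t + gaugeBracket d (N t) - N (gaugeBracket d t))

/-- The coboundary `𝕕` of the Lie algebroid `𝔇E`, acting on `E` in the obvious way, on a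
2-form `η : ∧²𝔇E → E`. -/
def extDeriv₂ (η : GaugeSec A S →ₗ[A] GaugeSec A S →ₗ[A] S) (d t k : GaugeSec A S) : S :=
  d.1 (η t k) - t.1 (η d k) + k.1 (η d t)
    - η (gaugeBracket d t) k + η (gaugeBracket d k) t - η (gaugeBracket t k) d

theorem GaugeTwoForm.swap (σ : GaugeTwoForm A S) (d t : GaugeSec A S) :
    σ.form d t = -σ.form t d := by
  have h := σ.alt (d + t)
  simp only [map_add, LinearMap.add_apply, σ.alt, zero_add, add_zero] at h
  rw [eq_neg_iff_add_eq_zero, ← h, add_comm]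

/-- `i_{d ∧ t} 𝕕σ = 𝕕σ(d, t, ·)`, a section of `𝔍E`. -/
def contractExtDeriv (σ : GaugeTwoForm A S) (d t : GaugeSec A S) : JetSec A S :=
  ⟨{ toFun := fun k => extDeriv₂ σ.form d t k
     map_add' := fun k l => by
       simp only [extDeriv₂, gaugeBracket_add_right, map_add, LinearMap.add_apply,
         Submodule.coe_add]
       abel
     map_smul' := fun f k => by
       obtain ⟨X, hX⟩ := d.2
       obtain ⟨Y, hY⟩ := t.2
       simp only [extDeriv₂, gaugeBracket_smul_right d k X hX, gaugeBracket_smul_right t k Y hY,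
         map_add, map_smul, LinearMap.add_apply, LinearMap.smul_apply, Submodule.coe_smul, hX, hY,
         RingHom.id_apply, smul_sub, smul_add, σ.swap k t, σ.swap k d, smul_neg]
       abel }, fun Φ => by
    obtain ⟨Ψ, hΨ, hΨ'⟩ := gaugeBracket_gl d Φ
    obtain ⟨Θ, hΘ, hΘ'⟩ := gaugeBracket_gl t Φ
    have key : ∀ (s : GaugeSec A S) (Φ : S →ₗ[A] S),
        σ.form s (glToGauge Φ) = Φ (σ.form s (glToGauge LinearMap.id)) := fun s => σ.mem_jet s
    have hgl : ∀ (Φ : S →ₗ[A] S) (u : S), (glToGauge Φ).1 u = Φ u := fun _ _ => rfl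
    simp only [LinearMap.coe_mk, AddHom.coe_mk, extDeriv₂, gaugeBracket_id, hΨ, hΘ,
      σ.swap (glToGauge _) _, key _ Φ, key _ Ψ, key _ Θ, hΨ', hΘ', hgl, map_zero,
      LinearMap.zero_apply, map_add, map_sub, LinearMap.id_apply]
    abel⟩

/-- `σ_N(d, t) = σ(N d, t)`. -/
def GaugeTwoForm.twist (σ : GaugeTwoForm A S) (N : GaugeSec A S →ₗ[A] GaugeSec A S) :
    GaugeSec A S →ₗ[A] GaugeSec A S →ₗ[A] S :=
  σ.form ∘ₗ N

end Omni

end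

end OmniLie

open OmniLie

namespace OmniLie

section Integrability

variable {A S : Type*} [CommRing A] [Algebra ℝ A] [AddCommGroup S] [Module ℝ S] [Module A S]
  [IsScalarTower ℝ A S]

/-! The argument is purely algebraic: it works for any commutative `ℝ`-algebra `A` and `A`-module
`S`, and needs no Jacobi identity. The bracket leaves the pairing invariant
(`omniPair_omniBracket_left`), and its symmetric part is exact (`omniBracket_swap`). Since `J` is
orthogonal with square `-1`, it is skew for the pairing. The derivative terms and exact terms that
would spoil skew-symmetry therefore cancel in the torsion, and `omniPair (torsion J e₁ e₂) e₃` is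
totally skew in its three arguments.

The pairing separates points, so every mixed component of the torsion is determined by its values on
two sections of `𝔍E` or on two sections of `𝔇E` (`torsion_eq_zero_iff`). Each of these values has a
`𝔇E` part and a `𝔍E` part, and expanding the block matrix identifies the four parts with the defects
in (i)-(iv). -/

/-! ### Evaluation rules for the pairing and the commutator -/

theorem pairE_add_left (μ ν : JetSec A S) (d : GaugeSec A S) :
    pairE (μ + ν) d = pairE μ d + pairE ν d := rfl

theorem pairE_sub_left (μ ν : JetSec A S) (d : GaugeSec A S) :
    pairE (μ - ν) d = pairE μ d - pairE ν d := rfl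

theorem pairE_neg_left (μ : JetSec A S) (d : GaugeSec A S) :
    pairE (-μ) d = -pairE μ d := rfl

theorem pairE_zero_left (d : GaugeSec A S) : pairE (0 : JetSec A S) d = 0 := rfl

theorem pairE_add_right (μ : JetSec A S) (d t : GaugeSec A S) :
    pairE μ (d + t) = pairE μ d + pairE μ t := map_add μ.1 d t

theorem pairE_neg_right (μ : JetSec A S) (d : GaugeSec A S) :
    pairE μ (-d) = -pairE μ d := map_neg μ.1 d

theorem pairE_zero_right (μ : JetSec A S) : pairE μ (0 : GaugeSec A S) = 0 := map_zero μ.1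

theorem pairE_lieDeriv (d t : GaugeSec A S) (μ : JetSec A S) :
    pairE (lieDeriv d μ) t = d.1 (pairE μ t) - pairE μ (gaugeBracket d t) := rfl

theorem pairE_jetD (u : S) (d : GaugeSec A S) : pairE (jetD u) d = d.1 u := rfl

theorem pairE_flat (σ : GaugeTwoForm A S) (d t : GaugeSec A S) :
    pairE (σ.flat d) t = σ.form d t := rfl

theorem pairE_dualMap (N : GaugeSec A S →ₗ[A] GaugeSec A S)
    (hN : ∀ ν ∈ JetSec A S, ν ∘ₗ N ∈ JetSec A S) (μ : JetSec A S) (d : GaugeSec A S) :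
    pairE (dualMap N hN μ) d = pairE μ (N d) := rfl

theorem pairE_contractExtDeriv (σ : GaugeTwoForm A S) (d t k : GaugeSec A S) :
    pairE (contractExtDeriv σ d t) k = extDeriv₂ σ.form d t k := rfl

theorem jet_ext {μ ν : JetSec A S} (h : ∀ d : GaugeSec A S, pairE μ d = pairE ν d) : μ = ν :=
  Subtype.ext (LinearMap.ext h)

theorem gaugeBracket_swap (d t : GaugeSec A S) : gaugeBracket d t = -gaugeBracket t d := by
  apply Subtype.ext
  ext u
  simp only [gaugeBracket_apply, Submodule.coe_neg, LinearMap.neg_apply, neg_sub]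

theorem gaugeBracket_zero_right (d : GaugeSec A S) : gaugeBracket d 0 = 0 := by
  apply Subtype.ext
  ext u
  simp [gaugeBracket_apply]

theorem gaugeBracket_zero_left (d : GaugeSec A S) : gaugeBracket 0 d = 0 := by
  rw [gaugeBracket_swap, gaugeBracket_zero_right, neg_zero]

theorem gaugeBracket_add_left (d t s : GaugeSec A S) :
    gaugeBracket (d + t) s = gaugeBracket d s + gaugeBracket t s := by
  rw [gaugeBracket_swap, gaugeBracket_add_right, neg_add, ← gaugeBracket_swap,
    ← gaugeBracket_swap]

theorem gauge_add_apply (d t : GaugeSec A S) (u : S) : (d + t).1 u = d.1 u + t.1 u := rfl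

theorem gauge_zero_apply (u : S) : (0 : GaugeSec A S).1 u = 0 := rfl

theorem JetTwoForm.swap (P : JetTwoForm A S) (μ ν : JetSec A S) :
    P.form μ ν = -P.form ν μ := by
  have h := P.alt (μ + ν)
  simp only [map_add, LinearMap.add_apply, P.alt, zero_add, add_zero] at h
  rw [eq_neg_iff_add_eq_zero, ← h, add_comm]

/-! ### The pairing and the bracket -/

theorem omniPair_comm (e₁ e₂ : OmniSec A S) : omniPair e₁ e₂ = omniPair e₂ e₁ := by
  simp only [omniPair, add_comm]

theorem omniPair_add_left (e₁ e₂ e₃ : OmniSec A S) :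
    omniPair (e₁ + e₂) e₃ = omniPair e₁ e₃ + omniPair e₂ e₃ := by
  simp only [omniPair, Prod.fst_add, Prod.snd_add, pairE_add_left, pairE_add_right, ← smul_add]
  congr 1
  abel

theorem omniPair_neg_left (e₁ e₂ : OmniSec A S) : omniPair (-e₁) e₂ = -omniPair e₁ e₂ := by
  simp only [omniPair, Prod.fst_neg, Prod.snd_neg, pairE_neg_left, pairE_neg_right, ← smul_neg]
  congr 1
  abel

theorem omniPair_sub_left (e₁ e₂ e₃ : OmniSec A S) :
    omniPair (e₁ - e₂) e₃ = omniPair e₁ e₃ - omniPair e₂ e₃ := by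
  rw [sub_eq_add_neg, omniPair_add_left, omniPair_neg_left, sub_eq_add_neg]

theorem omniPair_neg_right (e₁ e₂ : OmniSec A S) : omniPair e₁ (-e₂) = -omniPair e₁ e₂ := by
  rw [omniPair_comm, omniPair_neg_left, omniPair_comm]

theorem omniPair_eq_zero_iff (e₁ e₂ : OmniSec A S) :
    omniPair e₁ e₂ = 0 ↔ pairE e₁.2 e₂.1 + pairE e₂.2 e₁.1 = 0 := by
  have h : (1 / 2 : ℝ) ≠ 0 := by norm_num
  rw [omniPair, smul_eq_zero_iff_right h]

/-- Nondegeneracy on the `𝔇E` side: the jets `𝕕u` already separate operators, by `gauge_ext`. -/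
theorem fst_eq_zero_iff (e : OmniSec A S) :
    e.1 = 0 ↔ ∀ ν : JetSec A S, omniPair e (0, ν) = 0 := by
  simp only [omniPair_eq_zero_iff, pairE_zero_right, zero_add]
  exact ⟨fun h ν => by rw [h, pairE_zero_right],
    fun h => gauge_ext fun ν => by rw [h, pairE_zero_right]⟩

theorem snd_eq_zero_iff (e : OmniSec A S) :
    e.2 = 0 ↔ ∀ d : GaugeSec A S, omniPair e (d, 0) = 0 := by
  simp only [omniPair_eq_zero_iff, pairE_zero_left, add_zero]
  exact ⟨fun h d => by rw [h, pairE_zero_left],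
    fun h => jet_ext fun d => by rw [h, pairE_zero_left]⟩

theorem omniBracket_add_left (e₁ e₂ e₃ : OmniSec A S) :
    omniBracket (e₁ + e₂) e₃ = omniBracket e₁ e₃ + omniBracket e₂ e₃ := by
  refine Prod.ext (gaugeBracket_add_left _ _ _) (jet_ext fun k => ?_)
  simp only [omniBracket, Prod.fst_add, Prod.snd_add, pairE_add_left, pairE_sub_left,
    pairE_lieDeriv, pairE_jetD, gaugeBracket_add_left, pairE_add_right, map_add, gauge_add_apply]
  abel

theorem omniBracket_add_right (e₁ e₂ e₃ : OmniSec A S) :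
    omniBracket e₁ (e₂ + e₃) = omniBracket e₁ e₂ + omniBracket e₁ e₃ := by
  refine Prod.ext (gaugeBracket_add_right _ _ _) (jet_ext fun k => ?_)
  simp only [omniBracket, Prod.fst_add, Prod.snd_add, pairE_add_left, pairE_sub_left,
    pairE_lieDeriv, pairE_jetD, gaugeBracket_add_left, pairE_add_right, map_add, gauge_add_apply]
  abel

/-- The pairing is invariant under the bracket. -/
theorem omniPair_omniBracket_left (e₁ e₂ e₃ : OmniSec A S) :
    omniPair (omniBracket e₁ e₂) e₃
      = e₁.1.1 (omniPair e₂ e₃) - omniPair e₂ (omniBracket e₁ e₃) := by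
  simp only [omniPair, map_smul, ← smul_sub, omniBracket]
  congr 1
  simp only [pairE_add_left, pairE_sub_left, pairE_lieDeriv, pairE_jetD, map_add,
    gaugeBracket_swap e₃.1 e₂.1, pairE_neg_right]
  abel

/-- The symmetric part of the bracket is `𝕕` of the pairing. -/
theorem omniBracket_swap (e₁ e₂ : OmniSec A S) :
    omniBracket e₁ e₂ = -omniBracket e₂ e₁ + (0, jetD ((2 : ℝ) • omniPair e₁ e₂)) := by
  have h2 : (2 : ℝ) • omniPair e₁ e₂ = pairE e₁.2 e₂.1 + pairE e₂.2 e₁.1 := by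
    rw [omniPair, smul_smul]
    norm_num
  rw [h2]
  refine Prod.ext ?_ (jet_ext fun k => ?_)
  · simp only [omniBracket, Prod.fst_add, Prod.fst_neg, add_zero]
    exact gaugeBracket_swap _ _
  · simp only [omniBracket, Prod.snd_add, Prod.snd_neg, pairE_add_left, pairE_sub_left,
      pairE_neg_left, pairE_jetD, map_add]
    abel

/-! ### The torsion of a generalized almost complex structure -/

/-- The expression whose vanishing is the integrability of `J`. -/
def torsion (J : OmniSec A S →ₗ[A] OmniSec A S) (e₁ e₂ : OmniSec A S) : OmniSec A S :=
  omniBracket (J e₁) (J e₂) - omniBracket e₁ e₂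
    - J (omniBracket (J e₁) e₂ + omniBracket e₁ (J e₂))

variable {J : OmniSec A S →ₗ[A] OmniSec A S}

theorem torsion_add_left (e₁ e₂ e₃ : OmniSec A S) :
    torsion J (e₁ + e₂) e₃ = torsion J e₁ e₃ + torsion J e₂ e₃ := by
  simp only [torsion, map_add, omniBracket_add_left]
  abel

theorem torsion_add_right (e₁ e₂ e₃ : OmniSec A S) :
    torsion J e₁ (e₂ + e₃) = torsion J e₁ e₂ + torsion J e₁ e₃ := by
  simp only [torsion, map_add, omniBracket_add_right]
  abel

theorem IsGeneralizedAlmostComplex.omniPair_map_left (hJ : IsGeneralizedAlmostComplex J)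
    (e₁ e₂ : OmniSec A S) : omniPair (J e₁) e₂ = -omniPair e₁ (J e₂) := by
  rw [← hJ.2 e₁ (J e₂), hJ.1, omniPair_neg_right, neg_neg]

/-- The exact terms cancel in pairs: `J e₁, J e₂` against `e₁, e₂` by orthogonality, and the two
mixed brackets against each other because `J` is skew for the pairing. -/
theorem IsGeneralizedAlmostComplex.torsion_swap (hJ : IsGeneralizedAlmostComplex J)
    (e₁ e₂ : OmniSec A S) : torsion J e₁ e₂ = -torsion J e₂ e₁ := by
  have h0 : ((0, jetD 0) : OmniSec A S) = 0 :=
    Prod.ext rfl (jet_ext fun d => by simp [pairE_jetD, pairE_zero_left])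
  have h : omniBracket (J e₁) e₂ + omniBracket e₁ (J e₂)
      = -(omniBracket (J e₂) e₁ + omniBracket e₂ (J e₁)) := by
    have hs : ((0, jetD ((2 : ℝ) • omniPair (J e₁) e₂)) : OmniSec A S)
        + (0, jetD ((2 : ℝ) • omniPair e₁ (J e₂))) = 0 := by
      rw [← h0, hJ.omniPair_map_left]
      refine Prod.ext (add_zero _) (jet_ext fun d => ?_)
      simp [pairE_jetD, pairE_add_left]
    rw [omniBracket_swap (J e₁) e₂, omniBracket_swap e₁ (J e₂), add_add_add_comm, hs, add_zero]
    abel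
  rw [torsion, torsion, h, map_neg, omniBracket_swap (J e₁), omniBracket_swap e₁ e₂, hJ.2]
  abel

/-- Invariance moves each bracket onto `e₃` at the cost of a derivative of a pairing; the
derivatives along `e₁` and along `J e₁` cancel separately by orthogonality and skewness of `J`. -/
theorem IsGeneralizedAlmostComplex.omniPair_torsion_swap (hJ : IsGeneralizedAlmostComplex J)
    (e₁ e₂ e₃ : OmniSec A S) :
    omniPair (torsion J e₁ e₂) e₃ = -omniPair (torsion J e₁ e₃) e₂ := by
  -- Invariance is instantiated only at `e₂` and `J e₂`, so the brackets with `e₃` on the right-hand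
  -- side stay as they are.
  simp only [torsion, omniPair_sub_left, hJ.omniPair_map_left, omniPair_add_left,
    omniPair_omniBracket_left _ e₂, omniPair_omniBracket_left _ (J e₂), hJ.1, omniPair_neg_right,
    map_neg, omniPair_comm (omniBracket _ _)]
  abel

/-- By total skew-symmetry, the torsion vanishes as soon as it vanishes on pairs of sections of
`𝔇E` and on pairs of sections of `𝔍E`. -/
theorem IsGeneralizedAlmostComplex.torsion_eq_zero_iff (hJ : IsGeneralizedAlmostComplex J) :
    (∀ e₁ e₂, torsion J e₁ e₂ = 0) ↔
      (∀ μ ν : JetSec A S, torsion J (0, μ) (0, ν) = 0) ∧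
        ∀ d t : GaugeSec A S, torsion J (d, 0) (t, 0) = 0 := by
  refine ⟨fun h => ⟨fun _ _ => h _ _, fun _ _ => h _ _⟩, fun ⟨h₁, h₂⟩ => ?_⟩
  have pair_zero : ∀ e : OmniSec A S, omniPair 0 e = 0 := fun e => by
    rw [omniPair_eq_zero_iff]
    exact (zero_add _).trans (pairE_zero_right _)
  have h₃ : ∀ (d : GaugeSec A S) (ν : JetSec A S), torsion J (d, 0) (0, ν) = 0 := fun d ν => by
    -- Testing against a jet leaves two jets to be placed inside the torsion; testing against an
    -- operator leaves two operators.
    refine Prod.ext ((fst_eq_zero_iff _).2 fun μ => ?_) ((snd_eq_zero_iff _).2 fun t => ?_)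
    · rw [hJ.torsion_swap, omniPair_neg_left, hJ.omniPair_torsion_swap, h₁, pair_zero, neg_zero,
        neg_zero]
    · rw [hJ.omniPair_torsion_swap, h₂, pair_zero, neg_zero]
  intro e₁ e₂
  have split : ∀ e : OmniSec A S, e = (e.1, 0) + (0, e.2) := fun e => by simp
  rw [split e₁, split e₂, torsion_add_left, torsion_add_right, torsion_add_right, h₁, h₂, h₃,
    hJ.torsion_swap (0, e₁.2), h₃]
  simp

/-! ### The components of the torsion of a block matrix -/

variable {N : GaugeSec A S →ₗ[A] GaugeSec A S}
  {hN : ∀ ν ∈ JetSec A S, ν ∘ₗ N ∈ JetSec A S} {P : JetTwoForm A S} {σ : GaugeTwoForm A S}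

theorem blockMap_apply (e : OmniSec A S) :
    blockMap N hN P σ e = (N e.1 + P.sharp e.2, σ.flat e.1 - dualMap N hN e.2) := rfl

theorem blockMap_gauge (d : GaugeSec A S) : blockMap N hN P σ (d, 0) = (N d, σ.flat d) := by
  simp [blockMap_apply]

theorem blockMap_jet (μ : JetSec A S) :
    blockMap N hN P σ (0, μ) = (P.sharp μ, -dualMap N hN μ) := by
  simp [blockMap_apply]

/-- `𝔇E` is isotropic, so its image under the orthogonal map is isotropic too. -/
theorem IsGeneralizedAlmostComplex.form_map_left
    (hJ : IsGeneralizedAlmostComplex (blockMap N hN P σ)) (d t : GaugeSec A S) :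
    σ.form (N d) t = σ.form d (N t) := by
  have h : omniPair (blockMap N hN P σ (d, 0)) (blockMap N hN P σ (t, 0)) = 0 := by
    rw [hJ.2, omniPair_eq_zero_iff]
    simp [pairE_zero_left]
  rw [blockMap_gauge, blockMap_gauge, omniPair_eq_zero_iff, pairE_flat, pairE_flat,
    σ.swap t] at h
  exact (eq_of_sub_eq_zero (by rw [sub_eq_add_neg, h])).symm

theorem IsGeneralizedAlmostComplex.map_map
    (hJ : IsGeneralizedAlmostComplex (blockMap N hN P σ)) (d : GaugeSec A S) :
    N (N d) + P.sharp (σ.flat d) = -d := by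
  have h := congrArg Prod.fst (hJ.1 (d, 0))
  rwa [blockMap_gauge, blockMap_apply] at h

/-- Brackets of two jets vanish, so `N^⋆` drops out and only `π^♯` contributes; the sign of the
exact term comes from the skewness of `π`. -/
theorem omniBracket_jet_add (μ ν : JetSec A S) :
    omniBracket (blockMap N hN P σ (0, μ)) (0, ν) + omniBracket (0, μ) (blockMap N hN P σ (0, ν))
      = (0, piBracket P μ ν) := by
  rw [blockMap_jet, blockMap_jet]
  refine Prod.ext ?_ (jet_ext fun k => ?_)
  · simp [omniBracket, gaugeBracket_zero_left, gaugeBracket_zero_right]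
  · simp only [omniBracket, piBracket, Prod.snd_add, pairE_add_left, pairE_sub_left,
      pairE_lieDeriv, pairE_jetD, gauge_zero_apply, gaugeBracket_zero_left, pairE_zero_right,
      P.pairE_sharp, P.swap ν μ, map_neg, map_zero]
    abel

theorem torsion_jet_fst (μ ν : JetSec A S) :
    (torsion (blockMap N hN P σ) (0, μ) (0, ν)).1
      = gaugeBracket (P.sharp μ) (P.sharp ν) - P.sharp (piBracket P μ ν) := by
  rw [torsion, omniBracket_jet_add, blockMap_jet, blockMap_jet, blockMap_jet]
  simp [omniBracket, gaugeBracket_zero_left]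

theorem torsion_jet_snd (μ ν : JetSec A S) :
    (torsion (blockMap N hN P σ) (0, μ) (0, ν)).2
      = dualMap N hN (piBracket P μ ν) - (lieDeriv (P.sharp μ) (dualMap N hN ν)
          - lieDeriv (P.sharp ν) (dualMap N hN μ) - jetD (P.form (dualMap N hN μ) ν)) := by
  rw [torsion, omniBracket_jet_add, blockMap_jet, blockMap_jet, blockMap_jet]
  refine jet_ext fun k => ?_
  simp only [omniBracket, Prod.snd_sub, pairE_add_left, pairE_sub_left, pairE_neg_left,
    pairE_lieDeriv, pairE_jetD, gauge_zero_apply, gaugeBracket_zero_left, pairE_zero_right,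
    P.pairE_sharp, P.swap (dualMap N hN μ) ν, map_neg, map_zero]
  abel

/-- The jet part is Cartan's formula: `𝔏_d (σ_♮ t) - 𝔏_t (σ_♮ d) + 𝕕 (σ(d, t))` differs from the
contraction of `𝕕σ` by `σ_♮ [d, t]`. -/
theorem omniBracket_gauge_add (d t : GaugeSec A S) :
    omniBracket (blockMap N hN P σ (d, 0)) (t, 0) + omniBracket (d, 0) (blockMap N hN P σ (t, 0))
      = (gaugeBracket (N d) t + gaugeBracket d (N t),
          contractExtDeriv σ d t + σ.flat (gaugeBracket d t)) := by
  rw [blockMap_gauge, blockMap_gauge]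
  refine Prod.ext rfl (jet_ext fun k => ?_)
  simp only [omniBracket, Prod.snd_add, pairE_add_left, pairE_sub_left, pairE_lieDeriv,
    pairE_jetD, pairE_zero_left, pairE_flat, pairE_contractExtDeriv, extDeriv₂, map_zero,
    σ.swap (gaugeBracket d k), σ.swap (gaugeBracket t k)]
  abel

/-- The `N² [d, t]` term of the Nijenhuis tensor comes from `-[d, t] - π^♯ σ_♮ [d, t]`, by the upper
left entry of `J² = -1`. -/
theorem IsGeneralizedAlmostComplex.torsion_gauge_fst
    (hJ : IsGeneralizedAlmostComplex (blockMap N hN P σ)) (d t : GaugeSec A S) :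
    (torsion (blockMap N hN P σ) (d, 0) (t, 0)).1
      = nijenhuis N d t - P.sharp (contractExtDeriv σ d t) := by
  have h := hJ.map_map (gaugeBracket d t)
  rw [torsion, omniBracket_gauge_add, blockMap_gauge, blockMap_gauge, blockMap_apply]
  simp only [omniBracket, Prod.fst_sub, nijenhuis, map_add, map_sub]
  generalize P.sharp (σ.flat (gaugeBracket d t)) = s at h ⊢
  rw [eq_neg_iff_add_eq_zero, add_comm] at h
  rw [← sub_eq_zero, ← neg_eq_zero, ← h]
  abel

/-- After `N` is moved to the second slot of `σ` by `form_map_left`, both sides consist of the same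
terms. -/
theorem IsGeneralizedAlmostComplex.pairE_torsion_gauge_snd
    (hJ : IsGeneralizedAlmostComplex (blockMap N hN P σ)) (d t k : GaugeSec A S) :
    pairE (torsion (blockMap N hN P σ) (d, 0) (t, 0)).2 k
      = extDeriv₂ σ.form (N d) t k + extDeriv₂ σ.form d (N t) k + extDeriv₂ σ.form d t (N k)
        - extDeriv₂ (σ.twist N) d t k := by
  rw [torsion, omniBracket_gauge_add, blockMap_gauge, blockMap_gauge, blockMap_apply]
  simp only [omniBracket, Prod.snd_sub, pairE_add_left, pairE_sub_left, pairE_lieDeriv,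
    pairE_jetD, pairE_zero_left, pairE_flat, pairE_contractExtDeriv, pairE_dualMap, extDeriv₂,
    GaugeTwoForm.twist, LinearMap.comp_apply, hJ.form_map_left, map_zero, map_add,
    σ.swap (gaugeBracket (N d) k) t, σ.swap (gaugeBracket (N t) k) d]
  abel

/-! ### The equivalence, and its specialisation to vector bundles -/

theorem blockMap_isGeneralizedComplex_iff
    (hJ : IsGeneralizedAlmostComplex (blockMap N hN P σ)) :
    IsGeneralizedComplex (blockMap N hN P σ) ↔
      (∀ μ ν, P.sharp (piBracket P μ ν) = gaugeBracket (P.sharp μ) (P.sharp ν)) ∧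
      (∀ μ ν, dualMap N hN (piBracket P μ ν) =
        lieDeriv (P.sharp μ) (dualMap N hN ν) - lieDeriv (P.sharp ν) (dualMap N hN μ)
          - jetD (P.form (dualMap N hN μ) ν)) ∧
      (∀ d t, nijenhuis N d t = P.sharp (contractExtDeriv σ d t)) ∧
      (∀ d t k, extDeriv₂ σ.form (N d) t k + extDeriv₂ σ.form d (N t) k
          + extDeriv₂ σ.form d t (N k) = extDeriv₂ (σ.twist N) d t k) := by
  have hjet : ∀ μ : JetSec A S, μ = 0 ↔ ∀ k, pairE μ k = 0 :=
    fun μ => ⟨fun h k => by rw [h, pairE_zero_left], fun h => jet_ext h⟩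
  refine (and_iff_right hJ).trans (hJ.torsion_eq_zero_iff.trans ?_)
  -- `hjet` is applied only to the torsion of two operators: (iv) is tested on a third operator,
  -- while (ii) remains an equation between jets.
  simp only [Prod.ext_iff, Prod.fst_zero, Prod.snd_zero, torsion_jet_fst, torsion_jet_snd,
    hJ.torsion_gauge_fst, hjet (torsion _ (_, 0) _).2, hJ.pairE_torsion_gauge_snd, sub_eq_zero,
    forall_and, and_assoc]
  exact and_congr_left' ⟨fun h μ ν => (h μ ν).symm, fun h μ ν => (h μ ν).symm⟩

end Integrability

end OmniLie

theorem mainTheorem1 {n : ℕ} {M : Type*} [TopologicalSpace M]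
    [ChartedSpace (EuclideanSpace ℝ (Fin n)) M] [IsManifold (𝓡 n) ∞ M]
    [T2Space M] [SecondCountableTopology M]
    {F : Type*} [NormedAddCommGroup F] [NormedSpace ℝ F] [FiniteDimensional ℝ F]
    {E : M → Type*} [TopologicalSpace (Bundle.TotalSpace F E)]
    [∀ x, AddCommGroup (E x)] [∀ x, Module ℝ (E x)] [∀ x, TopologicalSpace (E x)]
    [FiberBundle F E] [VectorBundle ℝ F E] [ContMDiffVectorBundle ∞ F E (𝓡 n)]
    (N : GaugeSec C^∞⟮𝓡 n, M; ℝ⟯ Cₛ^∞⟮𝓡 n; F, E⟯ →ₗ[C^∞⟮𝓡 n, M; ℝ⟯]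
      GaugeSec C^∞⟮𝓡 n, M; ℝ⟯ Cₛ^∞⟮𝓡 n; F, E⟯)
    (hN : ∀ ν ∈ JetSec C^∞⟮𝓡 n, M; ℝ⟯ Cₛ^∞⟮𝓡 n; F, E⟯,
      ν ∘ₗ N ∈ JetSec C^∞⟮𝓡 n, M; ℝ⟯ Cₛ^∞⟮𝓡 n; F, E⟯)
    (P : JetTwoForm C^∞⟮𝓡 n, M; ℝ⟯ Cₛ^∞⟮𝓡 n; F, E⟯)
    (σ : GaugeTwoForm C^∞⟮𝓡 n, M; ℝ⟯ Cₛ^∞⟮𝓡 n; F, E⟯)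
    (hJ : IsGeneralizedAlmostComplex (blockMap N hN P σ)) :
    IsGeneralizedComplex (blockMap N hN P σ) ↔
      (∀ μ ν, P.sharp (piBracket P μ ν) = gaugeBracket (P.sharp μ) (P.sharp ν)) ∧
      (∀ μ ν, dualMap N hN (piBracket P μ ν) =
        lieDeriv (P.sharp μ) (dualMap N hN ν) - lieDeriv (P.sharp ν) (dualMap N hN μ)
          - jetD (P.form (dualMap N hN μ) ν)) ∧
      (∀ d t, nijenhuis N d t = P.sharp (contractExtDeriv σ d t)) ∧
      (∀ d t k, extDeriv₂ σ.form (N d) t k + extDeriv₂ σ.form d (N t) k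
          + extDeriv₂ σ.form d t (N k) = extDeriv₂ (σ.twist N) d t k) :=
  blockMap_isGeneralizedComplex_iff hJ
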